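/- Let $betw$ be the betweenness relation on $\mathbb{Q}$: $betw(x,y,z)$ holds if and only if $x\le y\le z$ or $z\le y\le x$. For a set $A$ let $\mathcal{O}_A=\bigsqcup_{n\ge 0}A^{A^n}$ be the set of all finitary operations $f\colon A^n\to A$ ($n\ge 0$) on $A$, with the topology of pointwise convergence: $A$ is discrete, each $A^{A^n}$ has the product topology, and $\mathcal{O}_A$ is the topological sum of these spaces. A clone on $A$ is a subset of $\mathcal{O}_A$ that contains all projections $(a_1,\dots,a_n)\mapsto a_i$ ($1\le i\le n$) and is closed under composition $(f,g_1,\dots,g_m)\mapsto f(g_1,\dots,g_m)$, where $f$ is $m$-ary and $g_1,\dots,g_m$ are $n$-ary; it carries the subspace topology. An isomorphism of clones is a bijection that preserves arities, projections and composition. Let $P=\mathrm{Pol}(\mathbb{Q},betw)$ be the clone of all $f\colon\mathbb{Q}^n\to\mathbb{Q}$ ($n\ge 0$) such that, whenever $betw(a_i,b_i,c_i)$ for all $i\le n$, also $betw(f(a_1,\dots,a_n),f(b_1,\dots,b_n),f(c_1,\dots,c_n))$. **Theorem.** $\mathrm{Pol}(\mathbb{Q},betw)$ has automatic homeomorphicity: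 for every countable set $\Omega$ and every clone $P'$ on $\Omega$ that is closed in $\mathcal{O}_\Omega$, every clone isomorphism $\theta\colon P\to P'$ is a homeomorphism. -/

import Mathlib

/-- The set `𝒪_A` of all finitary operations `A ^ n → A`, `n ≥ 0`, on a set `A`. -/
def FinitaryOp (A : Type*) : Type _ :=
  Σ n : ℕ, ((Fin n → A) → A)

/-- The topology of pointwise convergence on `𝒪_A`: the set `A` is discrete, the `n`-ary
operations carry the product topology of `A ^ (A ^ n)`, and `𝒪_A` is the topological sum of these
spaces over all `n`. The topology on `A` is given explicitly as `⊥` so that no other topology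
on `A` (for instance the metric one on `ℚ`) can be picked up. -/
instance FinitaryOp.instTopologicalSpace (A : Type*) : TopologicalSpace (FinitaryOp A) :=
  @instTopologicalSpaceSigma ℕ (fun n => (Fin n → A) → A)
    (fun n => @Pi.topologicalSpace (Fin n → A) (fun _ => A) (fun _ => (⊥ : TopologicalSpace A)))

/-- A (concrete) clone on `A`: a set of finitary operations on `A`, sorted by arity, that
contains all projections and is closed under composition. -/
structure ConcreteClone (A : Type*) where
  /-- the operations of arity `n` in the clone -/
  ops : ∀ n : ℕ, Set ((Fin n → A) → A)
  proj_mem : ∀ (n : ℕ) (i : Fin n), (fun x : Fin n → A => x i) ∈ ops n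
  comp_mem : ∀ (m n : ℕ) (f : (Fin m → A) → A) (g : Fin m → (Fin n → A) → A),
    f ∈ ops m → (∀ i, g i ∈ ops n) → (fun x : Fin n → A => f (fun i => g i x)) ∈ ops n

namespace ConcreteClone

/-- The clone as a subset of `𝒪_A`; it carries the subspace topology. -/
def toSet {A : Type*} (C : ConcreteClone A) : Set (FinitaryOp A) :=
  {f | f.2 ∈ C.ops f.1}

/-- The `i`-th `n`-ary projection as an element of the clone. -/
def proj {A : Type*} (C : ConcreteClone A) (n : ℕ) (i : Fin n) : C.ops n :=
  ⟨fun x => x i, C.proj_mem n i⟩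

/-- The composition `f (g₁, …, gₘ)` as an element of the clone. -/
def comp {A : Type*} (C : ConcreteClone A) {m n : ℕ} (f : C.ops m) (g : Fin m → C.ops n) :
    C.ops n :=
  ⟨fun x => f.1 (fun i => (g i).1 x), C.comp_mem m n f.1 (fun i => (g i).1) f.2 fun i => (g i).2⟩

/-- An isomorphism of clones: an arity-preserving bijection that preserves projections and
composition. -/
structure Iso {A B : Type*} (C : ConcreteClone A) (D : ConcreteClone B) where
  equiv : ∀ n : ℕ, C.ops n ≃ D.ops n
  map_proj : ∀ (n : ℕ) (i : Fin n), equiv n (C.proj n i) = D.proj n i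
  map_comp : ∀ (m n : ℕ) (f : C.ops m) (g : Fin m → C.ops n),
    equiv n (C.comp f g) = D.comp (equiv m f) (fun i => equiv n (g i))

/-- The map between the underlying sets of operations given by a clone isomorphism. -/
def Iso.toMap {A B : Type*} {C : ConcreteClone A} {D : ConcreteClone B} (θ : Iso C D)
    (f : C.toSet) : D.toSet :=
  ⟨⟨f.1.1, (θ.equiv f.1.1 ⟨f.1.2, f.2⟩).1⟩, (θ.equiv f.1.1 ⟨f.1.2, f.2⟩).2⟩

/-- The polymorphism clone `Pol (A, R)` of a set with a ternary relation: all operations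
of arity `n ≥ 0` that preserve `R`. -/
def pol {A : Type*} (R : A → A → A → Prop) : ConcreteClone A where
  ops n := {f | ∀ a b c : Fin n → A, (∀ i, R (a i) (b i) (c i)) → R (f a) (f b) (f c)}
  proj_mem _ i := fun _ _ _ h => h i
  comp_mem _ _ _ _ hf hg := fun _ _ _ h => hf _ _ _ fun i => hg i _ _ _ h

end ConcreteClone

/-- The (reflexive) betweenness relation on `ℚ`. -/
def betw (x y z : ℚ) : Prop :=
  (x ≤ y ∧ y ≤ z) ∨ (z ≤ y ∧ y ≤ x)

/-! Continuity of the inverse comes from the constants: nullary operations name points of `Ω`, and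
the values of `θ f` at named points determine `f`.

For continuity of `θ`, polymorphisms of `betw` are essentially unary, with monotone or antitone
unary part. The group `ℚ ≃o ℚ` acts on `Ω` through `θ`. Since `θ⁻¹` is a continuous injection on the
Polish space of unary operations of the closed clone, Lusin–Souslin makes the transporters traces of
Borel sets. Baire category then makes stabilizers open: every point of `Ω` has a finite support.
Strictly monotone maps are pointwise limits of automorphisms, and closedness of the clone carries
finite supports over to them. Monotone maps factor through strictly monotone ones with a fixed left
factor, and negation handles antitone maps. -/

open Filter Topology

/-! ### Pointwise convergence and clone isomorphisms -/

namespace FinitaryOp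

/-- An `n`-ary operation as an element of `𝒪_A`. -/
def mk {A : Type*} (n : ℕ) (f : (Fin n → A) → A) : FinitaryOp A :=
  ⟨n, f⟩

theorem mem_nhds_iff {A : Type*} {n : ℕ} {f : (Fin n → A) → A} {s : Set (FinitaryOp A)} :
    s ∈ 𝓝 (mk n f) ↔ ∃ F : Finset (Fin n → A),
      ∀ g : (Fin n → A) → A, (∀ a ∈ F, g a = f a) → mk n g ∈ s := by
  let : TopologicalSpace A := ⊥
  have : DiscreteTopology A := ⟨rfl⟩
  have h : 𝓝 (mk n f) = map (mk n) (𝓝 f) :=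
    Sigma.nhds_mk (σ := fun n => (Fin n → A) → A) n f
  rw [h, mem_map, nhds_pi, Filter.mem_pi']
  constructor
  · rintro ⟨F, t, ht, hs⟩
    refine ⟨F, fun g hg => hs fun a ha => ?_⟩
    rw [hg a ha]
    exact mem_of_mem_nhds (ht a)
  · rintro ⟨F, hF⟩
    refine ⟨F, fun a => {f a}, fun a => by simp [nhds_discrete], fun g hg => hF g fun a ha => ?_⟩
    exact hg a ha

end FinitaryOp

namespace ConcreteClone

variable {A B : Type*} {C : ConcreteClone A} {D : ConcreteClone B}

theorem mem_ops_of_isClosed (hC : IsClosed C.toSet) {n : ℕ} {m : (Fin n → A) → A}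
    (h : ∀ F : Finset (Fin n → A), ∃ g ∈ C.ops n, ∀ a ∈ F, g a = m a) : m ∈ C.ops n := by
  have : FinitaryOp.mk n m ∈ C.toSet := by
    rw [← hC.closure_eq, mem_closure_iff_nhds]
    intro t ht
    obtain ⟨F, hF⟩ := FinitaryOp.mem_nhds_iff.1 ht
    obtain ⟨g, hg, hgF⟩ := h F
    exact ⟨.mk n g, hF g hgF, hg⟩
  exact this

theorem isClosed_ops [TopologicalSpace A] [DiscreteTopology A] (hC : IsClosed C.toSet) (n : ℕ) :
    IsClosed (C.ops n) := by
  refine isClosed_of_closure_subset fun m hm => mem_ops_of_isClosed hC fun F => ?_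
  have hopen : IsOpen {g : (Fin n → A) → A | ∀ a ∈ F, g a = m a} := by
    have : {g : (Fin n → A) → A | ∀ a ∈ F, g a = m a} = ⋂ a ∈ F, {g | g a = m a} := by
      ext; simp
    rw [this]
    refine isOpen_biInter_finset fun a _ => ?_
    exact (isOpen_discrete {m a}).preimage
      (continuous_apply (A := fun _ : Fin n → A => A) a)
  obtain ⟨g, hg, hgC⟩ := mem_closure_iff.1 hm _ hopen fun _ _ => rfl
  exact ⟨g, hgC, hg⟩

namespace Iso

/-- The inverse of a clone isomorphism. -/
def symm (θ : Iso C D) : Iso D C where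
  equiv n := (θ.equiv n).symm
  map_proj n i := by rw [Equiv.symm_apply_eq, θ.map_proj]
  map_comp m n f g := by
    rw [Equiv.symm_apply_eq, θ.map_comp]
    simp

theorem continuous_toMap (θ : Iso C D)
    (h : ∀ (n : ℕ) (f : C.ops n) (x : Fin n → B), ∃ F : Finset (Fin n → A), ∀ g : C.ops n,
      (∀ a ∈ F, g.1 a = f.1 a) → (θ.equiv n g).1 x = (θ.equiv n f).1 x) :
    Continuous θ.toMap := by
  classical
  rw [continuous_iff_continuousAt]
  rintro ⟨⟨n, f⟩, hf⟩
  change Tendsto _ _ _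
  rw [nhds_subtype, nhds_subtype, tendsto_comap_iff]
  intro s hs
  obtain ⟨K, hK⟩ := FinitaryOp.mem_nhds_iff.1 hs
  choose F hF using h n ⟨f, hf⟩
  refine mem_comap.2 ⟨{g | ∀ hg : g ∈ C.toSet, (θ.toMap ⟨g, hg⟩).1 ∈ s}, ?_, fun g hg => hg g.2⟩
  refine FinitaryOp.mem_nhds_iff.2 ⟨K.biUnion F, fun g hg hgC => hK _ fun x hx => ?_⟩
  exact hF x ⟨g, hgC⟩ fun a ha => hg a (Finset.mem_biUnion.2 ⟨x, hx, ha⟩)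

theorem isHomeomorph_toMap (θ : Iso C D) (h : Continuous θ.toMap)
    (h' : Continuous θ.symm.toMap) : IsHomeomorph θ.toMap := by
  refine isHomeomorph_iff_exists_inverse.2 ⟨h, θ.symm.toMap, ?_, ?_, h'⟩
  · rintro ⟨⟨n, f⟩, hf⟩
    exact Subtype.ext (congrArg (fun g : C.ops n => FinitaryOp.mk n g.1)
      ((θ.equiv n).symm_apply_apply ⟨f, hf⟩))
  · rintro ⟨⟨n, f⟩, hf⟩
    exact Subtype.ext (congrArg (fun g : D.ops n => FinitaryOp.mk n g.1)
      ((θ.equiv n).apply_symm_apply ⟨f, hf⟩))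

end Iso

end ConcreteClone

/-! ### Baire category and finite supports -/

/-- In a Baire group, the stabilizers of an action on a countable set all of whose transporters
have the Baire property are neighbourhoods of `1`. -/
theorem MulAction.stabilizer_mem_nhds_one {G Ω : Type*} [Group G] [TopologicalSpace G]
    [BaireSpace G] [SeparatelyContinuousMul G] [Countable Ω] [MulAction G Ω] (ω : Ω)
    (h : ∀ x : Ω, BaireMeasurableSet {g : G | g • ω = x}) :
    {g : G | g • ω = ω} ∈ 𝓝 (1 : G) := by
  choose u hu hBu using fun x => (h x).residualEq_isOpen
  -- Countably many transporters cover `G`, so they cannot all be meagre.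
  obtain ⟨x, g₀, hg₀⟩ : ∃ x, (u x).Nonempty := by
    by_contra! hne
    have hall : ∀ᶠ g in residual G, ∀ x, (g • ω = x ↔ g ∈ u x) :=
      eventually_countable_forall.2 fun x => (hBu x).mem_iff
    obtain ⟨g, hg⟩ := (dense_of_mem_residual hall).nonempty
    simpa [hne] using (hg (g • ω)).1 rfl
  have hcont : Continuous fun v : G => g₀ * v := by fun_prop
  -- For `v` near `1`, a generic `g` in a nonempty open set has both `g` and `g * v` sending `ω` to
  -- `x`.
  filter_upwards [((hu x).preimage hcont).mem_nhds (by simpa using hg₀)] with v hv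
  have hr : Tendsto (fun g : G => g * v) (residual G) (residual G) :=
    tendsto_residual_of_isOpenMap (Homeomorph.mulRight v).continuous
      (Homeomorph.mulRight v).isOpenMap
  have hres := (hBu x).mem_iff.and (hr.eventually (hBu x).mem_iff)
  obtain ⟨g, hgu, hg⟩ := (dense_of_mem_residual hres).inter_open_nonempty
    (u x ∩ (fun g => g * v) ⁻¹' u x)
    ((hu x).inter ((hu x).preimage (Homeomorph.mulRight v).continuous)) ⟨g₀, hg₀, hv⟩
  have h₁ : g • ω = x := hg.1.2 hgu.1
  have h₂ : (g * v) • ω = x := hg.2.2 hgu.2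
  rw [mul_smul, ← h₁] at h₂
  exact smul_left_cancel g h₂

/-- If the transporters of an action of `Aut (A, ≤)`, `A` countable, on a countable set are traces
of Borel sets of functions, then every point has a finite support. -/
theorem OrderIso.exists_finset_smul_eq {A Ω : Type*} [LinearOrder A] [Countable A]
    [TopologicalSpace A] [DiscreteTopology A] [Countable Ω] [MulAction (A ≃o A) Ω] (ω : Ω)
    (h : ∀ x : Ω, ∃ T : Set (A → A), @MeasurableSet _ (borel (A → A)) T ∧
      ∀ g : A ≃o A, g • ω = x ↔ ⇑g ∈ T) :
    ∃ F : Finset A, ∀ g : A ≃o A, (∀ a ∈ F, g a = a) → g • ω = ω := by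
  classical
  -- Recording the inverse too makes the range closed; bijectivity alone is not a closed condition.
  let ι : (A ≃o A) → (A → A) × (A → A) := fun g => (g, g.symm)
  let : TopologicalSpace (A ≃o A) := TopologicalSpace.induced ι inferInstance
  have hι : IsInducing ι := ⟨rfl⟩
  have hιc : Continuous ι := hι.continuous
  have hval : ∀ a, Continuous fun g : A ≃o A => g a := fun a =>
    (continuous_apply a).comp (continuous_fst.comp hιc)
  have hinv : ∀ a, Continuous fun g : A ≃o A => g.symm a := fun a =>
    (continuous_apply a).comp (continuous_snd.comp hιc)
  have hrange : Set.range ι = {p | (∀ a b, a ≤ b → p.1 a ≤ p.1 b) ∧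
      (∀ a b, a ≤ b → p.2 a ≤ p.2 b) ∧ (∀ a, p.2 (p.1 a) = a) ∧ ∀ a, p.1 (p.2 a) = a} := by
    ext ⟨p, q⟩
    constructor
    · rintro ⟨g, hg⟩
      obtain ⟨rfl, rfl⟩ := Prod.mk.inj hg
      exact ⟨fun a b hab => g.monotone hab, fun a b hab => g.symm.monotone hab,
        g.symm_apply_apply, g.apply_symm_apply⟩
    · rintro ⟨hp, hq, hqp, hpq⟩
      refine ⟨⟨⟨p, q, hqp, hpq⟩, fun {a b} => ⟨fun hab => ?_, hp a b⟩⟩, rfl⟩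
      calc a = q (p a) := (hqp a).symm
        _ ≤ q (p b) := hq _ _ hab
        _ = b := hqp b
  have hcomp : ∀ a : A, Continuous fun p : (A → A) × (A → A) => p.2 (p.1 a) := by
    intro a
    have : Continuous fun q : (A → A) × A => q.1 q.2 :=
      continuous_prod_of_discrete_right.2 fun b => continuous_apply b
    exact this.comp (continuous_snd.prodMk ((continuous_apply a).comp continuous_fst))
  have hcomp' : ∀ a : A, Continuous fun p : (A → A) × (A → A) => p.1 (p.2 a) := fun a =>
    (hcomp a).comp continuous_swap
  have hle : ∀ {X : Type _} [TopologicalSpace X] {f g : X → A}, Continuous f → Continuous g →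
      IsClosed {x | f x ≤ g x} := fun hf hg =>
    (isClosed_discrete {q : A × A | q.1 ≤ q.2}).preimage (hf.prodMk hg)
  have hclosed : IsClosed (Set.range ι) := by
    rw [hrange]
    simp only [Set.ofPred_and, Set.ofPred_forall]
    refine .inter ?_ (.inter ?_ (.inter ?_ ?_))
    · exact isClosed_iInter fun a => isClosed_iInter fun b => isClosed_iInter fun _ =>
        hle (by fun_prop) (by fun_prop)
    · exact isClosed_iInter fun a => isClosed_iInter fun b => isClosed_iInter fun _ =>
        hle (by fun_prop) (by fun_prop)
    · exact isClosed_iInter fun a => isClosed_eq (hcomp a) continuous_const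
    · exact isClosed_iInter fun a => isClosed_eq (hcomp' a) continuous_const
  have hemb : IsClosedEmbedding ι :=
    ⟨⟨hι, fun g g' hgg => DFunLike.coe_injective (congrArg Prod.fst hgg)⟩, hclosed⟩
  have : PolishSpace ((A → A) × (A → A)) := { }
  have : PolishSpace (A ≃o A) := hemb.polishSpace
  have : SeparatelyContinuousMul (A ≃o A) := by
    constructor
    · intro v
      refine hι.continuous_iff.2 (Continuous.prodMk (continuous_pi fun a => ?_)
        (continuous_pi fun a => ?_))
      · exact continuous_of_discreteTopology.comp (hval a)
      · exact hinv (v.symm a)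
    · intro v
      refine hι.continuous_iff.2 (Continuous.prodMk (continuous_pi fun a => ?_)
        (continuous_pi fun a => ?_))
      · exact hval (v a)
      · exact (continuous_of_discreteTopology (f := v.symm)).comp (hinv a)
  have hstab := MulAction.stabilizer_mem_nhds_one ω fun x => by
    obtain ⟨T, hT, hgT⟩ := h x
    borelize (A → A) (A ≃o A)
    have hc : Continuous fun g : A ≃o A => (g : A → A) := continuous_fst.comp hιc
    have : {g : A ≃o A | g • ω = x} = (fun g : A ≃o A => (g : A → A)) ⁻¹' T := Set.ext hgT
    rw [this]
    exact (hc.measurable hT).baireMeasurableSet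
  rw [hι.nhds_eq_comap, mem_comap] at hstab
  obtain ⟨t, ht, hts⟩ := hstab
  rw [nhds_prod_eq, mem_prod_iff] at ht
  obtain ⟨s₁, hs₁, s₂, hs₂, hst⟩ := ht
  rw [nhds_pi, Filter.mem_pi'] at hs₁ hs₂
  obtain ⟨F₁, t₁, ht₁, h₁⟩ := hs₁
  obtain ⟨F₂, t₂, ht₂, h₂⟩ := hs₂
  refine ⟨F₁ ∪ F₂, fun g hg => hts (hst ⟨h₁ fun a ha => ?_, h₂ fun a ha => ?_⟩)⟩
  · have : (ι g).1 a = a := hg a (Finset.mem_union_left _ ha)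
    rw [this]
    exact mem_of_mem_nhds (ht₁ a)
  · have : (ι g).2 a = a := g.symm_apply_eq.2 (hg a (Finset.mem_union_right _ ha)).symm
    rw [this]
    exact mem_of_mem_nhds (ht₂ a)

/-- Back and forth: a strictly monotone map agrees with an automorphism on any finite set. -/
theorem StrictMono.exists_orderIso_eqOn {A : Type*} [LinearOrder A] [Countable A]
    [DenselyOrdered A] [NoMinOrder A] [NoMaxOrder A] {e : A → A} (he : StrictMono e)
    (F : Finset A) : ∃ g : A ≃o A, ∀ a ∈ F, g a = e a := by
  classical
  rcases isEmpty_or_nonempty A with hA | hA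
  · exact ⟨OrderIso.refl A, fun a => hA.elim a⟩
  cases nonempty_encodable A
  open Order Order.PartialIso in
  let p : PartialIso A A := ⟨F.image fun a => (a, e a), by
    intro p hp q hq
    obtain ⟨a, -, rfl⟩ := Finset.mem_image.1 hp
    obtain ⟨b, -, rfl⟩ := Finset.mem_image.1 hq
    exact (he.cmp_map_eq a b).symm⟩
  open Order Order.PartialIso in
  let toCofinal : A ⊕ A → Cofinal (PartialIso A A) := fun q =>
    Sum.recOn q (definedAtLeft A) (definedAtRight A)
  open Order Order.PartialIso in
  let I : Ideal (PartialIso A A) := idealOfCofinals p toCofinal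
  let f a := Order.PartialIso.funOfIdeal a I
    (Order.cofinal_meets_idealOfCofinals p toCofinal (Sum.inl a))
  let k b := Order.PartialIso.invOfIdeal b I
    (Order.cofinal_meets_idealOfCofinals p toCofinal (Sum.inr b))
  have hcmp : ∀ {a b : A × A}, (∃ r ∈ I, a ∈ r.val) → (∃ r ∈ I, b ∈ r.val) →
      cmp a.1 b.1 = cmp a.2 b.2 := by
    rintro a b ⟨r, hr, har⟩ ⟨s, hs, hbs⟩
    obtain ⟨m, -, hrm, hsm⟩ := I.directed _ hr _ hs
    exact m.prop _ (hrm har) _ (hsm hbs)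
  refine ⟨OrderIso.ofCmpEqCmp (fun a => (f a).val) (fun b => (k b).val) fun a b =>
    hcmp (f a).prop (k b).prop, fun a ha => ?_⟩
  have hp : p ∈ I := Order.mem_idealOfCofinals p toCofinal
  have := hcmp (f a).prop ⟨p, hp, Finset.mem_image_of_mem (fun a => (a, e a)) ha⟩
  exact (cmp_eq_eq_iff _ _).1 (this.symm.trans (cmp_self_eq_eq a))

/-! ### Polymorphisms of betweenness -/

theorem betw_update {n : ℕ} (z w : Fin n → ℚ) (i : Fin n) (a b : ℚ) (j : Fin n) :
    betw (Function.update z i a j) (Function.update z i b j) (Function.update w i b j) := by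
  rcases eq_or_ne j i with rfl | hj
  · simp only [Function.update_self, betw]
    rcases le_total a b with h | h
    · exact .inl ⟨h, le_rfl⟩
    · exact .inr ⟨le_rfl, h⟩
  · simp only [Function.update_of_ne hj, betw]
    rcases le_total (z j) (w j) with h | h
    · exact .inl ⟨le_rfl, h⟩
    · exact .inr ⟨h, le_rfl⟩

theorem betw_iff_monotone_or_antitone {f : ℚ → ℚ} :
    (∀ a b c, betw a b c → betw (f a) (f b) (f c)) ↔ Monotone f ∨ Antitone f := by
  constructor
  · intro h
    by_contra hne
    obtain ⟨a, b, c, hab, hbc, hf⟩ :=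
      not_monotone_not_antitone_iff_exists_le_le.1 (not_or.1 hne)
    rcases h a b c (.inl ⟨hab, hbc⟩) with h' | h' <;> rcases hf with hf | hf <;> linarith
  · rintro (h | h) a b c (⟨h₁, h₂⟩ | ⟨h₁, h₂⟩)
    · exact .inl ⟨h h₁, h h₂⟩
    · exact .inr ⟨h h₁, h h₂⟩
    · exact .inr ⟨h h₂, h h₁⟩
    · exact .inl ⟨h h₂, h h₁⟩

namespace ConcreteClone

/-- In the cycle `za, zb, wb, wa` each of the four values lies between its two neighbours. If `za <
zb`, then `wa ≤ za` and `zb ≤ wb`, so `wb`, lying between `wa` and `zb`, equals `zb`. -/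
theorem pol_betw_update_eq {n : ℕ} {f : (Fin n → ℚ) → ℚ} (hf : f ∈ (pol betw).ops n) {i : Fin n}
    {z : Fin n → ℚ} {a b : ℚ} (h : f (Function.update z i a) ≠ f (Function.update z i b))
    (w : Fin n → ℚ) : f (Function.update w i b) = f (Function.update z i b) := by
  have h₁ := hf _ _ _ (betw_update z w i a b)
  have h₂ := hf _ _ _ (betw_update z w i b a)
  have h₃ := hf _ _ _ (betw_update w z i a b)
  have h₄ := hf _ _ _ (betw_update w z i b a)
  generalize f (Function.update z i a) = za at *
  generalize f (Function.update z i b) = zb at *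
  generalize f (Function.update w i a) = wa at *
  generalize f (Function.update w i b) = wb at *
  unfold betw at *
  grind

/-- Polymorphisms of the betweenness relation depend on at most one argument. -/
theorem pol_betw_essentially_unary {n : ℕ} {f : (Fin (n + 1) → ℚ) → ℚ}
    (hf : f ∈ (pol betw).ops (n + 1)) : ∃ i, ∀ x y, x i = y i → f x = f y := by
  by_cases hne : ∃ i z a b, f (Function.update z i a) ≠ f (Function.update z i b)
  · obtain ⟨i, z, a, b, hab⟩ := hne
    refine ⟨i, fun x y hxy => ?_⟩
    have key : ∀ c, f (Function.update x i c) ≠ f (Function.update x i (x i)) → f x = f y := by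
      intro c hc
      have := pol_betw_update_eq hf hc y
      rwa [hxy, Function.update_eq_self, ← hxy, Function.update_eq_self, eq_comm] at this
    -- The two distinct values at `a` and `b` persist over `x`, so one of them differs from `f x`.
    have ha := pol_betw_update_eq hf hab.symm x
    have hb := pol_betw_update_eq hf hab x
    by_cases h : f (Function.update x i a) = f (Function.update x i (x i))
    · refine key b fun h' => hab ?_
      rw [← ha, ← hb, h, h']
    · exact key a h
  · push Not at hne
    have key : ∀ (x y : Fin (n + 1) → ℚ) (s : Finset (Fin (n + 1))),
        f (s.piecewise x y) = f y := by
      intro x y s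
      induction s using Finset.induction_on with
      | empty => simp
      | insert j s _ ih =>
        rw [Finset.piecewise_insert, ← ih, hne j _ _ (s.piecewise x y j),
          Function.update_eq_self]
    exact ⟨0, fun x y _ => by simpa using key x y Finset.univ⟩

/-- The unary map `u` belongs to the clone `C`. -/
def HasUnary {A : Type*} (C : ConcreteClone A) (u : A → A) : Prop :=
  (fun x : Fin 1 → A => u (x 0)) ∈ C.ops 1

theorem hasUnary_pol_betw {u : ℚ → ℚ} :
    (pol betw).HasUnary u ↔ Monotone u ∨ Antitone u := by
  rw [← betw_iff_monotone_or_antitone]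
  exact ⟨fun h a b c habc => h (fun _ => a) (fun _ => b) (fun _ => c) fun _ => habc,
    fun h a b c habc => h _ _ _ (habc 0)⟩

theorem hasUnary_of_monotone {u : ℚ → ℚ} (hu : Monotone u) : (pol betw).HasUnary u :=
  hasUnary_pol_betw.2 (.inl hu)

theorem const_mem_pol_betw (a : ℚ) : (fun _ : Fin 0 → ℚ => a) ∈ (pol betw).ops 0 :=
  fun _ _ _ _ => .inl ⟨le_rfl, le_rfl⟩

theorem mem_pol_betw_succ {n : ℕ} {f : (Fin (n + 1) → ℚ) → ℚ}
    (hf : f ∈ (pol betw).ops (n + 1)) :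
    ∃ i, ∃ u : ℚ → ℚ, (pol betw).HasUnary u ∧ f = fun x => u (x i) := by
  obtain ⟨i, hi⟩ := pol_betw_essentially_unary hf
  exact ⟨i, fun q => f fun _ => q, fun a b c h => hf _ _ _ fun _ => h 0,
    funext fun x => hi _ _ rfl⟩

theorem HasUnary.comp {A : Type*} {C : ConcreteClone A} {u v : A → A} (hu : C.HasUnary u)
    (hv : C.HasUnary v) : C.HasUnary (u ∘ v) :=
  C.comp_mem 1 1 _ (fun _ => _) hu fun _ => hv

/-! ### Named points and the action on `Ω` -/

namespace Iso

variable {A Ω : Type*} {C : ConcreteClone A} {D : ConcreteClone Ω} (θ : Iso C D)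

/-- The map of `Ω` that is the image of the unary map `u`. -/
def unary {u : A → A} (hu : C.HasUnary u) (ω : Ω) : Ω :=
  (θ.equiv 1 ⟨_, hu⟩).1 fun _ => ω

theorem equiv_apply_eq_unary {n : ℕ} (f : C.ops n) {u : A → A} (hu : C.HasUnary u) {i : Fin n}
    (hf : f.1 = fun x => u (x i)) (x : Fin n → Ω) : (θ.equiv n f).1 x = θ.unary hu (x i) := by
  have h : f = C.comp (m := 1) ⟨_, hu⟩ fun _ => C.proj n i := Subtype.ext hf
  rw [h, θ.map_comp]
  simp only [θ.map_proj]
  rfl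

theorem unary_congr {u v : A → A} (hu : C.HasUnary u) (h : u = v) (ω : Ω) :
    θ.unary hu ω = θ.unary (h ▸ hu : C.HasUnary v) ω := by
  subst h; rfl

theorem unary_comp {u v : A → A} (hu : C.HasUnary u) (hv : C.HasUnary v) (ω : Ω) :
    θ.unary (hu.comp hv) ω = θ.unary hu (θ.unary hv ω) := by
  have h := θ.map_comp 1 1 ⟨_, hu⟩ fun _ => ⟨_, hv⟩
  exact congrFun (congrArg Subtype.val h) fun _ => ω

theorem unary_id (h : C.HasUnary id) (ω : Ω) : θ.unary h ω = ω :=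
  congrFun (congrArg Subtype.val (θ.map_proj 1 0)) fun _ => ω

variable (hC : ∀ a : A, (fun _ : Fin 0 → A => a) ∈ C.ops 0)

/-- The point of `Ω` named by the image of the nullary operation `a`. -/
def point (a : A) : Ω :=
  (θ.equiv 0 ⟨_, hC a⟩).1 Fin.elim0

theorem point_injective : Function.Injective (θ.point hC) := by
  intro a b hab
  have h : θ.equiv 0 ⟨_, hC a⟩ = θ.equiv 0 ⟨_, hC b⟩ := by
    refine Subtype.ext (funext fun x => ?_)
    rw [Subsingleton.elim x Fin.elim0]
    exact hab
  exact congrFun (congrArg Subtype.val ((θ.equiv 0).injective h)) Fin.elim0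

/-- Evaluation at constants is composition with nullary operations, which `θ` preserves. -/
theorem equiv_apply_point {n : ℕ} (f : C.ops n) (x : Fin n → A) :
    (θ.equiv n f).1 (fun i => θ.point hC (x i)) = θ.point hC (f.1 x) :=
  (congrFun (congrArg Subtype.val (θ.map_comp n 0 f fun i => ⟨_, hC (x i)⟩)) Fin.elim0).symm

theorem continuous_symm_toMap (hC : ∀ a : A, (fun _ : Fin 0 → A => a) ∈ C.ops 0) :
    Continuous θ.symm.toMap := by
  refine θ.symm.continuous_toMap fun n f x =>
    ⟨{fun i => θ.point hC (x i)}, fun g hg => θ.point_injective hC ?_⟩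
  rw [← equiv_apply_point, ← equiv_apply_point]
  have h : ∀ k : D.ops n, θ.equiv n (θ.symm.equiv n k) = k := (θ.equiv n).apply_symm_apply
  rw [h, h]
  exact hg _ (Finset.mem_singleton_self _)

/-- Every point of `Ω` has a finite support with respect to the automorphisms of `(A, ≤)`. -/
theorem exists_finset_orderIso_unary_eq [LinearOrder A] [Countable A] [Countable Ω]
    (hD : IsClosed D.toSet) (hC : ∀ a : A, (fun _ : Fin 0 → A => a) ∈ C.ops 0)
    (hG : ∀ g : A ≃o A, C.HasUnary g) (ω : Ω) :
    ∃ F : Finset A, ∀ g : A ≃o A, (∀ a ∈ F, g a = a) → θ.unary (hG g) ω = ω := by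
  let : TopologicalSpace A := ⊥
  let : TopologicalSpace Ω := ⊥
  have : DiscreteTopology A := ⟨rfl⟩
  have : DiscreteTopology Ω := ⟨rfl⟩
  have : PolishSpace ((Fin 1 → Ω) → Ω) := { }
  have : PolishSpace (D.ops 1) := (isClosed_ops hD 1).polishSpace
  let act : MulAction (A ≃o A) Ω :=
    { smul := fun g => θ.unary (hG g)
      one_smul := θ.unary_id (hG 1)
      mul_smul := fun g h => θ.unary_comp (hG g) (hG h) }
  -- This is `θ⁻¹` on unary operations; each value of `φ m` is read off from one value of `m` at a
  -- named point.
  let φ : D.ops 1 → A → A := fun m a => ((θ.equiv 1).symm m).1 fun _ => a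
  have hφ : ∀ m a, θ.point hC (φ m a) = m.1 fun _ => θ.point hC a := by
    intro m a
    rw [← equiv_apply_point, Equiv.apply_symm_apply]
  have hφc : Continuous φ := by
    refine continuous_pi fun a => ?_
    have : Nonempty A := ⟨a⟩
    have hinv : (fun m => φ m a) =
        Function.invFun (θ.point hC) ∘ fun m : D.ops 1 => m.1 fun _ => θ.point hC a := by
      funext m
      rw [Function.comp_apply, ← hφ, Function.leftInverse_invFun (θ.point_injective hC)]
    rw [hinv]
    exact continuous_of_discreteTopology.comp
      ((continuous_apply (A := fun _ : Fin 1 → Ω => Ω) _).comp continuous_subtype_val)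
  have hφi : Function.Injective φ := by
    intro m m' h
    refine (θ.equiv 1).symm.injective (Subtype.ext (funext fun x => ?_))
    have hx : x = fun _ => x 0 := funext fun i => congrArg x (Subsingleton.elim i 0)
    rw [hx]
    exact congrFun h (x 0)
  have hφθ : ∀ g : A ≃o A, φ (θ.equiv 1 ⟨_, hG g⟩) = g := by
    intro g
    funext a
    simp only [φ, Equiv.symm_apply_apply]
  refine OrderIso.exists_finset_smul_eq ω fun x => ?_
  borelize (A → A) ↥(D.ops 1)
  have hS : IsClosed {m : D.ops 1 | m.1 (fun _ => ω) = x} :=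
    (isClosed_discrete {x}).preimage
      ((continuous_apply (A := fun _ : Fin 1 → Ω => Ω) _).comp continuous_subtype_val)
  -- Lusin–Souslin: a continuous injection of Polish spaces maps Borel sets to Borel sets.
  refine ⟨φ '' {m | m.1 (fun _ => ω) = x},
    (hφc.measurableEmbedding hφi).measurableSet_image.2 hS.measurableSet, fun g => ?_⟩
  constructor
  · exact fun h => ⟨_, h, hφθ g⟩
  · rintro ⟨m, hm, hmg⟩
    rw [← hφθ g] at hmg
    rw [hφi hmg] at hm
    exact hm

end Iso

end ConcreteClone

/-! ### From automorphisms to all polymorphisms -/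

namespace ConcreteClone.Iso

variable {Ω : Type*} [Countable Ω] {D : ConcreteClone Ω} (θ : Iso (pol betw) D)

theorem exists_finset_strictMono_unary_eq (hD : IsClosed D.toSet) (ω : Ω) :
    ∃ F : Finset ℚ, ∀ e e' : ℚ → ℚ, ∀ (he : StrictMono e) (he' : StrictMono e'),
      (∀ a ∈ F, e a = e' a) → θ.unary (hasUnary_of_monotone he.monotone) ω =
        θ.unary (hasUnary_of_monotone he'.monotone) ω := by
  classical
  have hG : ∀ g : ℚ ≃o ℚ, (pol betw).HasUnary g := fun g => hasUnary_of_monotone g.monotone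
  choose F hF using θ.exists_finset_orderIso_unary_eq hD const_mem_pol_betw hG
  have hFF : ∀ ω (g h : ℚ ≃o ℚ), (∀ a ∈ F ω, g a = h a) →
      θ.unary (hG g) ω = θ.unary (hG h) ω := by
    intro ω g h hgh
    have hfix := hF ω (h⁻¹ * g) fun a ha => by
      change h.symm (g a) = a
      rw [hgh a ha, h.symm_apply_apply]
    conv_rhs => rw [← hfix]
    rw [← θ.unary_comp]
    exact θ.unary_congr _ (funext fun q => (h.apply_symm_apply (g q)).symm) ω
  have key : ∀ {e : ℚ → ℚ} (he : StrictMono e) (ω : Ω) (g : ℚ ≃o ℚ), (∀ a ∈ F ω, g a = e a) →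
      θ.unary (hasUnary_of_monotone he.monotone) ω = θ.unary (hG g) ω := by
    intro e he
    choose g hg using fun ω => he.exists_orderIso_eqOn (F ω)
    -- The expected `θ e`: at each point, act by an automorphism agreeing with `e` on a support. It
    -- is a limit of images of automorphisms, and its values at named points show that `θ⁻¹ m` is
    -- `e`.
    let m : (Fin 1 → Ω) → Ω := fun x => θ.unary (hG (g (x 0))) (x 0)
    have hm : m ∈ D.ops 1 := by
      refine mem_ops_of_isClosed hD fun K => ?_
      obtain ⟨h, hh⟩ := he.exists_orderIso_eqOn (K.biUnion fun x => F (x 0))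
      refine ⟨(θ.equiv 1 ⟨_, hG h⟩).1, (θ.equiv 1 ⟨_, hG h⟩).2, fun x hx => ?_⟩
      rw [θ.equiv_apply_eq_unary ⟨_, hG h⟩ (hG h) rfl]
      refine hFF _ _ _ fun a ha => ?_
      rw [hg _ a ha, hh a (Finset.mem_biUnion.2 ⟨x, hx, ha⟩)]
    have hme : (θ.equiv 1).symm ⟨m, hm⟩ = ⟨_, hasUnary_of_monotone he.monotone⟩ := by
      refine Subtype.ext (funext fun x => θ.point_injective const_mem_pol_betw ?_)
      rw [← equiv_apply_point, Equiv.apply_symm_apply]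
      set p := θ.point const_mem_pol_betw (x 0)
      obtain ⟨h, hh⟩ := he.exists_orderIso_eqOn (insert (x 0) (F p))
      have h₁ : θ.unary (hG (g p)) p = θ.unary (hG h) p := hFF _ _ _ fun a ha => by
        rw [hg p a ha, hh a (Finset.mem_insert_of_mem ha)]
      refine h₁.trans ((θ.equiv_apply_point const_mem_pol_betw ⟨_, hG h⟩ fun _ => x 0).trans ?_)
      exact congrArg _ (hh _ (Finset.mem_insert_self _ _))
    intro ω h hh
    rw [Equiv.symm_apply_eq] at hme
    have h₂ : m (fun _ => ω) = θ.unary (hasUnary_of_monotone he.monotone) ω :=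
      congrFun (congrArg Subtype.val hme) fun _ => ω
    rw [← h₂]
    exact hFF _ _ _ fun a ha => by rw [hg ω a ha, hh a ha]
  refine ⟨F ω, fun e e' he he' hee => ?_⟩
  obtain ⟨g, hg⟩ := he.exists_orderIso_eqOn (F ω)
  rw [key he ω g hg, key he' ω g fun a ha => (hg a ha).trans (hee a ha)]

/-- A monotone map `u` factors as `p ∘ e`, where `p` is a fixed monotone map with dense fibres and
`e` is the strictly monotone map `q ↦ (u q, q)` into the lexicographic square. -/
theorem exists_finset_monotone_unary_eq (hD : IsClosed D.toSet) (ω : Ω) :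
    ∃ F : Finset ℚ, ∀ u v : ℚ → ℚ, ∀ (hu : Monotone u) (hv : Monotone v),
      (∀ a ∈ F, u a = v a) →
        θ.unary (hasUnary_of_monotone hu) ω = θ.unary (hasUnary_of_monotone hv) ω := by
  have : Countable (ℚ ×ₗ ℚ) := inferInstanceAs (Countable (ℚ × ℚ))
  obtain ⟨ι⟩ : Nonempty (ℚ ×ₗ ℚ ≃o ℚ) := Order.iso_of_countable_dense _ _
  let p : ℚ → ℚ := fun q => (ofLex (ι.symm q)).1
  have hp : Monotone p := fun a b hab => Prod.Lex.monotone_fst _ _ (ι.symm.monotone hab)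
  let e : (ℚ → ℚ) → ℚ → ℚ := fun u q => ι (toLex (u q, q))
  have he : ∀ {u : ℚ → ℚ}, Monotone u → StrictMono (e u) := by
    intro u hu a b hab
    refine ι.strictMono (Prod.Lex.toLex_lt_toLex.2 ?_)
    exact (hu hab.le).lt_or_eq.imp_right fun h => ⟨h, hab⟩
  have hpe : ∀ u, u = p ∘ e u := fun u => funext fun q => by simp [p, e]
  obtain ⟨F, hF⟩ := θ.exists_finset_strictMono_unary_eq hD ω
  refine ⟨F, fun u v hu hv huv => ?_⟩
  -- As `p` is the same for `u` and `v`, only the strictly monotone factors need comparing, and `e u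
  -- a` depends only on `u a` and `a`.
  rw [θ.unary_congr _ (hpe u), θ.unary_congr _ (hpe v),
    θ.unary_comp (hasUnary_of_monotone hp) (hasUnary_of_monotone (he hu).monotone),
    θ.unary_comp (hasUnary_of_monotone hp) (hasUnary_of_monotone (he hv).monotone),
    hF _ _ (he hu) (he hv) fun a ha => by simp only [e, huv a ha]]

theorem exists_finset_antitone_unary_eq (hD : IsClosed D.toSet) (ω : Ω) :
    ∃ F : Finset ℚ, ∀ u v : ℚ → ℚ, ∀ (hu : Antitone u) (hv : Antitone v),
      (∀ a ∈ F, u a = v a) → θ.unary (hasUnary_pol_betw.2 (.inr hu)) ω =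
        θ.unary (hasUnary_pol_betw.2 (.inr hv)) ω := by
  classical
  have hneg : Antitone (Neg.neg : ℚ → ℚ) := fun _ _ => neg_le_neg
  have hneg' := hasUnary_pol_betw.2 (.inr hneg)
  obtain ⟨F, hF⟩ := θ.exists_finset_monotone_unary_eq hD (θ.unary hneg' ω)
  have key : ∀ u : ℚ → ℚ, u = (u ∘ Neg.neg) ∘ Neg.neg := fun u => funext fun q => by simp
  refine ⟨F.image Neg.neg, fun u v hu hv huv => ?_⟩
  rw [θ.unary_congr _ (key u), θ.unary_congr _ (key v),
    θ.unary_comp (hasUnary_of_monotone (hu.comp hneg)) hneg',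
    θ.unary_comp (hasUnary_of_monotone (hv.comp hneg)) hneg']
  exact hF _ _ (hu.comp hneg) (hv.comp hneg) fun a ha => huv _ (Finset.mem_image_of_mem _ ha)

/-- A failure of monotonicity or antitonicity of `u` is witnessed by two points; adding them to the
finite set forces `u` to share the direction of `v`. -/
theorem exists_finset_unary_eq (hD : IsClosed D.toSet) {u : ℚ → ℚ} (hu : (pol betw).HasUnary u)
    (ω : Ω) : ∃ F : Finset ℚ, ∀ (v : ℚ → ℚ) (hv : (pol betw).HasUnary v),
      (∀ a ∈ F, v a = u a) → θ.unary hv ω = θ.unary hu ω := by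
  classical
  obtain ⟨F₁, h₁⟩ := θ.exists_finset_monotone_unary_eq hD ω
  obtain ⟨F₂, h₂⟩ := θ.exists_finset_antitone_unary_eq hD ω
  have hmono : ∃ F : Finset ℚ, ∀ v : ℚ → ℚ, (∀ a ∈ F, v a = u a) → Monotone v → Monotone u := by
    by_cases h : Monotone u
    · exact ⟨∅, fun _ _ _ => h⟩
    · unfold Monotone at h
      push Not at h
      obtain ⟨a, b, hab, hlt⟩ := h
      refine ⟨{a, b}, fun v hv hmv => absurd (hmv hab) ?_⟩
      rw [hv a (by simp), hv b (by simp)]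
      exact hlt.not_ge
  have hanti : ∃ F : Finset ℚ, ∀ v : ℚ → ℚ, (∀ a ∈ F, v a = u a) → Antitone v → Antitone u := by
    by_cases h : Antitone u
    · exact ⟨∅, fun _ _ _ => h⟩
    · unfold Antitone at h
      push Not at h
      obtain ⟨a, b, hab, hlt⟩ := h
      refine ⟨{a, b}, fun v hv hmv => absurd (hmv hab) ?_⟩
      rw [hv a (by simp), hv b (by simp)]
      exact hlt.not_ge
  obtain ⟨F₃, h₃⟩ := hmono
  obtain ⟨F₄, h₄⟩ := hanti
  refine ⟨F₁ ∪ F₂ ∪ F₃ ∪ F₄, fun v hv hvu => ?_⟩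
  simp only [Finset.mem_union] at hvu
  rcases hasUnary_pol_betw.1 hv with h | h
  · exact h₁ v u h (h₃ v (fun a ha => hvu a (by tauto)) h) fun a ha => hvu a (by tauto)
  · exact h₂ v u h (h₄ v (fun a ha => hvu a (by tauto)) h) fun a ha => hvu a (by tauto)

theorem exists_finset_equiv_eq (hD : IsClosed D.toSet) {n : ℕ} (f : (pol betw).ops n)
    (x : Fin n → Ω) : ∃ F : Finset (Fin n → ℚ), ∀ g : (pol betw).ops n,
      (∀ a ∈ F, g.1 a = f.1 a) → (θ.equiv n g).1 x = (θ.equiv n f).1 x := by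
  classical
  obtain _ | n := n
  · refine ⟨{Fin.elim0}, fun g hg => ?_⟩
    have : g = f := Subtype.ext (funext fun a => by
      rw [Subsingleton.elim a Fin.elim0]
      exact hg _ (Finset.mem_singleton_self _))
    rw [this]
  have key : ∀ i : Fin (n + 1), ∃ F : Finset (Fin (n + 1) → ℚ), ∀ (g : (pol betw).ops (n + 1))
      (v : ℚ → ℚ), (pol betw).HasUnary v → (g.1 = fun x => v (x i)) →
      (∀ a ∈ F, g.1 a = f.1 a) → (θ.equiv _ g).1 x = (θ.equiv _ f).1 x := by
    intro i
    by_cases hi : ∀ y z, y i = z i → f.1 y = f.1 z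
    · have hu : (pol betw).HasUnary fun q => f.1 fun _ => q := fun a b c h => f.2 _ _ _ fun _ => h 0
      obtain ⟨F, hF⟩ := θ.exists_finset_unary_eq hD hu (x i)
      refine ⟨F.image fun q _ => q, fun g v hv hgv hgf => ?_⟩
      rw [θ.equiv_apply_eq_unary g hv hgv,
        θ.equiv_apply_eq_unary f hu (funext fun y => hi _ _ rfl)]
      refine hF v hv fun a ha => ?_
      rw [← hgf _ (Finset.mem_image_of_mem _ ha), hgv]
    -- Two tuples witness that `f` does not depend on coordinate `i` alone, so no `g` agreeing with
    -- `f` there does either.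
    · push Not at hi
      obtain ⟨y, z, hyz, hne⟩ := hi
      refine ⟨{y, z}, fun g v hv hgv hgf => absurd ?_ hne⟩
      rw [← hgf y (by simp), ← hgf z (by simp), hgv]
      exact congrArg v hyz
  choose F hF using key
  refine ⟨Finset.univ.biUnion F, fun g hg => ?_⟩
  obtain ⟨i, v, hv, hgv⟩ := mem_pol_betw_succ g.2
  exact hF i g v hv hgv fun a ha => hg a (Finset.mem_biUnion.2 ⟨i, Finset.mem_univ i, ha⟩)

end ConcreteClone.Iso

theorem theorem5p1 {Ω : Type*} [Countable Ω] (P' : ConcreteClone Ω)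
    (hP' : IsClosed P'.toSet)
    (θ : ConcreteClone.Iso (ConcreteClone.pol betw) P') :
    IsHomeomorph θ.toMap := by
  exact θ.isHomeomorph_toMap
    (θ.continuous_toMap fun _ f x => θ.exists_finset_equiv_eq hP' f x)
    (θ.continuous_symm_toMap ConcreteClone.const_mem_pol_betw)
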